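/- For a Riemannian manifold with boundary $X$ (connected, complete) with Riemannian distance $d_X$, boundary $\partial X$ and a Borel probability measure $\mu_X$, put $\rho_{\partial X}(x)=d_X(x,\partial X)$. For $\Omega\subset X$ let $\operatorname{InRad}\Omega=\sup_{x\in\Omega}\rho_{\partial X}(x)$ (and $\operatorname{InRad}\emptyset=0$), and for $\xi\le 1$ let $$\operatorname{PartInRad}(X;\xi)=\inf\{\operatorname{InRad}\Omega : \Omega\subset X \text{ Borel},\ \mu_X(\Omega)\ge\xi\}.$$ Let $I=[0,\infty)$ with its usual distance and boundary $\{0\}$. For $\eta>0$ let $$\operatorname{ObsInRad}(X;-\eta)=\sup_{\varphi}\operatorname{PartInRad}\bigl((I,d_I,\varphi_{\#}\mu_X);1-\eta\bigr),$$ the supremum being over all $1$-Lipschitz $\varphi:X\to I$ with $\varphi|_{\partial X}=0$. A sequence $\{X_n\}$ of such spaces is a boundary concentration family if $\lim_{n\to\infty}\operatorname{ObsInRad}(X_n;-\eta)=0$ for every $\eta>0$. For $\kappa\in\mathbb R$ and $n\ge 2$ let $M^n_\kappa$ be the $n$-dimensional space form of constant curvature $\kappa$. Corollary 1.5. Let $\kappa,\lambda\in\mathbb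 R$ satisfy the convex-ball-condition: $\kappa>0$ and $\lambda\ge 0$; or $\kappa=0$ and $\lambda>0$; or $\kappa<0$ and $\lambda>\sqrt{|\kappa|}$. Then there is a number $C_{\kappa,\lambda}>0$, independent of $n$, such that for every $n\ge 2$ a closed ball of positive radius $R$ in $M^n_\kappa$ has nonempty boundary of constant mean curvature $(n-1)\lambda$ (the trace of the shape operator with respect to the unit inner normal) if and only if $R=C_{\kappa,\lambda}$. Let $B^n_{\kappa,\lambda}$ be the closed ball of radius $C_{\kappa,\lambda}$ in $M^n_\kappa$, regarded as a Riemannian manifold with boundary, with its own Riemannian distance and its Riemannian volume measure normalized to total mass $1$. Then the sequence $\{B^n_{\kappa,\lambda}\}$ is a boundary concentration family. -/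

import Mathlib

open Set Filter Topology MeasureTheory
open scoped NNReal ENNReal

noncomputable section

namespace BoundaryConcentration

/-! ### Invariants of metric measure spaces with boundary

The invariants below depend only on the distance function `d`, the Borel measure `μ` and the
boundary `bd` of the space `X`. All of them take values in `[0, ∞]`, so that no infimum or supremum
has a junk value. -/

section Invariants

variable {X : Type*}

/-- The distance from the boundary, `ρ_{∂X}(x) = d(x, ∂X)`. -/
def rhoBoundary (d : X → X → ℝ≥0∞) (bd : Set X) (x : X) : ℝ≥0∞ :=
  ⨅ y ∈ bd, d x y

/-- The inscribed radius of a subset `Ω ⊆ X`: the supremum of `ρ_{∂X}` over `Ω`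
(which is `0` if `Ω` is empty). -/
def inRad (d : X → X → ℝ≥0∞) (bd Ω : Set X) : ℝ≥0∞ :=
  ⨆ x ∈ Ω, rhoBoundary d bd x

/-- The `ξ`-partial inscribed radius: the infimum of the inscribed radii of the Borel sets of
measure at least `ξ`. -/
def partInRad [MeasurableSpace X] (d : X → X → ℝ≥0∞) (μ : Measure X) (bd : Set X) (ξ : ℝ) :
    ℝ≥0∞ :=
  ⨅ (Ω : Set X) (_ : MeasurableSet Ω ∧ ENNReal.ofReal ξ ≤ μ Ω), inRad d bd Ω

/-- The `η`-observable inscribed radius `ObsInRad(X; -η)`: the supremum of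
`PartInRad(I_φ; 1 - η)` over all `1`-Lipschitz functions `φ : X → I = [0, ∞)` vanishing on the
boundary, where the screen `I_φ` is `I` with its usual distance, the push-forward measure `φ_# μ`
and the boundary `∂I = {0}`. -/
def obsInRad [MeasurableSpace X] (d : X → X → ℝ≥0∞) (μ : Measure X) (bd : Set X) (η : ℝ) :
    ℝ≥0∞ :=
  ⨆ (φ : X → ℝ≥0) (_ : (∀ x y, edist (φ x) (φ y) ≤ d x y) ∧ ∀ x ∈ bd, φ x = 0),
    partInRad (fun s t : ℝ≥0 => edist s t) (μ.map φ) {0} (1 - η)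

end Invariants

/-- A sequence of metric measure spaces with boundary is a boundary concentration family if
`ObsInRad(X_n; -η) → 0` for every `η > 0`. -/
def IsBoundaryConcentrationFamily (X : ℕ → Type*) [∀ n, MeasurableSpace (X n)]
    (d : ∀ n, X n → X n → ℝ≥0∞) (μ : ∀ n, Measure (X n)) (bd : ∀ n, Set (X n)) : Prop :=
  ∀ η : ℝ, 0 < η → Tendsto (fun n => obsInRad (d n) (μ n) (bd n) η) atTop (𝓝 0)

/-! ### Riemannian geometry in one coordinate system

A Riemannian metric in coordinates is given by the functions `g x u v = g_x(u, v)`. -/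

/-- The coordinate space `ℝⁿ`. -/
abbrev E (n : ℕ) : Type := EuclideanSpace ℝ (Fin n)

section Riemannian

variable {n : ℕ}

/-- The `i`-th coordinate vector field. -/
def e (i : Fin n) : E n := EuclideanSpace.single i (1 : ℝ)

/-- The Gram matrix `(g_ij)` at `x`. -/
def gram (g : E n → E n → E n → ℝ) (x : E n) : Matrix (Fin n) (Fin n) ℝ :=
  Matrix.of fun i j => g x (e i) (e j)

/-- The Riemannian volume measure `√(det g_ij) dx`. -/
def riemVolume (g : E n → E n → E n → ℝ) : Measure (E n) :=
  volume.withDensity fun x => ENNReal.ofReal (√(gram g x).det)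

/-- The length of a `C¹` curve `γ` defined on `[0, 1]`. -/
def riemLength (g : E n → E n → E n → ℝ) (γ : ℝ → E n) : ℝ≥0∞ :=
  ∫⁻ t in Icc (0 : ℝ) 1,
    ENNReal.ofReal
      (√(g (γ t) (derivWithin γ (Icc (0 : ℝ) 1) t) (derivWithin γ (Icc (0 : ℝ) 1) t)))

/-- The Riemannian distance of the manifold (with or without boundary) `A ⊆ ℝⁿ`: the infimum of
the lengths of the `C¹` curves in `A` that join `x` to `y`. -/
def riemEDist (g : E n → E n → E n → ℝ) (A : Set (E n)) (x y : E n) : ℝ≥0∞ :=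
  ⨅ (γ : ℝ → E n) (_ : ContDiffOn ℝ 1 γ (Icc 0 1) ∧ MapsTo γ (Icc 0 1) A ∧ γ 0 = x ∧ γ 1 = y),
    riemLength g γ

/-- The partial derivative `∂_i f`. -/
def partialD (i : Fin n) (f : E n → ℝ) (x : E n) : ℝ := fderiv ℝ f x (e i)

/-- The Christoffel symbols
`Γ^k_ij = ½ ∑_l g^{kl} (∂_i g_jl + ∂_j g_il - ∂_l g_ij)` of the Levi-Civita connection. -/
def christoffel (g : E n → E n → E n → ℝ) (x : E n) (k i j : Fin n) : ℝ :=
  1 / 2 * ∑ l, (gram g x)⁻¹ k l *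
    (partialD i (fun y => gram g y j l) x + partialD j (fun y => gram g y i l) x
      - partialD l (fun y => gram g y i j) x)

/-- The Levi-Civita covariant derivative `(∇_u V)(x)`. -/
def covDeriv (g : E n → E n → E n → ℝ) (u : E n) (V : E n → E n) (x : E n) : E n :=
  fderiv ℝ V x u + ∑ k, (∑ i, ∑ j, christoffel g x k i j * u i * V x j) • e k

/-- `v` is tangent to `S` at `y`: it is the velocity of a curve in `S` through `y`. -/
def IsTangentTo (S : Set (E n)) (y v : E n) : Prop :=
  ∃ γ : ℝ → E n, γ 0 = y ∧ HasDerivAt γ v 0 ∧ ∀ᶠ t in 𝓝 0, γ t ∈ S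

/-- On the open set `W`, the `C¹` vector field `ν` extends the unit inner normal field of the
boundary of `B`. -/
structure IsInnerUnitNormalOn (g : E n → E n → E n → ℝ) (B W : Set (E n)) (ν : E n → E n) :
    Prop where
  contDiffOn : ContDiffOn ℝ 1 ν W
  unit : ∀ y ∈ W ∩ frontier B, g y (ν y) (ν y) = 1
  normal : ∀ y ∈ W ∩ frontier B, ∀ v, IsTangentTo (frontier B) y v → g y (ν y) v = 0
  inner : ∀ y ∈ W ∩ frontier B, ∀ᶠ t : ℝ in 𝓝[>] 0, y + t • ν y ∈ B

/-- The mean curvature of the boundary of `B` at `z` is `h`: with `ν` the unit inner normal field,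
`h` is the trace of the shape operator `A v = -∇_v ν` of the tangent space at `z`, computed in an
orthonormal basis `b`. In particular round balls have positive mean curvature in this sign
convention. -/
def HasBoundaryMeanCurvatureAt (g : E n → E n → E n → ℝ) (B : Set (E n)) (z : E n) (h : ℝ) :
    Prop :=
  ∃ (W : Set (E n)) (ν : E n → E n), IsOpen W ∧ z ∈ W ∧ IsInnerUnitNormalOn g B W ν ∧
    ∃ b : Fin (n - 1) → E n,
      (∀ i, IsTangentTo (frontier B) z (b i)) ∧
      (∀ i j, g z (b i) (b j) = if i = j then 1 else 0) ∧
      h = ∑ i, g z (-covDeriv g (b i) ν z) (b i)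

end Riemannian

/-! ### Space forms and ball model spaces -/

/-- The coordinate domain of the `n`-dimensional space form of constant curvature `κ` in conformal
coordinates around a point: all of `ℝⁿ` if `κ = 0`; all of `ℝⁿ` if `κ > 0`, where it represents the
round sphere without the antipode of the centre (stereographic projection); the open ball of radius
`2 / √|κ|` if `κ < 0` (the Poincaré model). -/
def spaceFormDomain (κ : ℝ) (n : ℕ) : Set (E n) :=
  {x | 0 < 1 + κ / 4 * ‖x‖ ^ 2}

/-- The metric `|dx|² / (1 + κ|x|²/4)²` of constant curvature `κ`. -/
def spaceFormMetric (κ : ℝ) (n : ℕ) (x u v : E n) : ℝ :=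
  ((1 + κ / 4 * ‖x‖ ^ 2)⁻¹) ^ 2 * inner ℝ u v

/-- The closed metric ball of radius `R` around the origin of the space form. -/
def spaceFormBall (κ : ℝ) (n : ℕ) (R : ℝ) : Set (E n) :=
  {x ∈ spaceFormDomain κ n |
    riemEDist (spaceFormMetric κ n) (spaceFormDomain κ n) 0 x ≤ ENNReal.ofReal R}

/-- The closed ball of radius `R > 0` in the `n`-dimensional space form of curvature `κ` has a
nonempty boundary, whose mean curvature is constantly `(n - 1) λ`. (For `κ > 0` nonemptiness of
the boundary means `R < π / √κ`.) -/
structure IsBallModelRadius (κ lam : ℝ) (n : ℕ) (R : ℝ) : Prop where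
  pos : 0 < R
  boundary_nonempty : (frontier (spaceFormBall κ n R)).Nonempty
  meanCurvature : ∀ z ∈ frontier (spaceFormBall κ n R),
    HasBoundaryMeanCurvatureAt (spaceFormMetric κ n) (spaceFormBall κ n R) z (((n : ℝ) - 1) * lam)

/-- The Riemannian distance of the closed ball, as a Riemannian manifold with boundary: curves have
to stay in the ball. -/
def ballEDist (κ : ℝ) (n : ℕ) (R : ℝ) (x y : spaceFormBall κ n R) : ℝ≥0∞ :=
  riemEDist (spaceFormMetric κ n) (spaceFormBall κ n R) x y

/-- The Riemannian volume measure of the closed ball, normalized to total mass one. -/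
def ballMeasure (κ : ℝ) (n : ℕ) (R : ℝ) : Measure (spaceFormBall κ n R) :=
  (riemVolume (spaceFormMetric κ n) (spaceFormBall κ n R))⁻¹ •
    (riemVolume (spaceFormMetric κ n)).comap Subtype.val

/-- The boundary of the closed ball, as a subset of the ball. -/
def ballBoundary (κ : ℝ) (n : ℕ) (R : ℝ) : Set (spaceFormBall κ n R) :=
  Subtype.val ⁻¹' frontier (spaceFormBall κ n R)

/-- The ball-condition for `κ` and `λ`. -/
def BallCondition (κ lam : ℝ) : Prop :=
  0 < κ ∨ (κ = 0 ∧ 0 < lam) ∨ (κ < 0 ∧ √|κ| < lam)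

/-- The convex-ball-condition for `κ` and `λ`. -/
def ConvexBallCondition (κ lam : ℝ) : Prop :=
  BallCondition κ lam ∧ 0 ≤ lam

end BoundaryConcentration

end

open BoundaryConcentration

/-!
In the conformal coordinates of the space form the metric at `x` is `(1 + κ‖x‖²/4)⁻²` times the
Euclidean one, so the problem reduces to explicit computations with this factor.

The Riemannian distance from the origin is `ρ(‖x‖)`, where `ρ(r) = ∫₀ʳ (1 + κs²/4)⁻¹ ds`
(`riemEDist_zero`): segments through the origin attain this length, and a function with gradient of
norm at most one shows that no curve is shorter. For `κ ≤ 0` this function is `ρ` composed with the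
projection to a line; for `κ ≥ 0` it is `ρ` of a smoothed norm. Hence a geodesic ball with nonempty
boundary is a Euclidean ball of some radius `r`, and `ρ` is strictly increasing.

The unit inner normal of such a ball is radial, and the conformal formula for the Levi-Civita
connection shows that every principal curvature of its boundary is `(1 - κr²/4)/r`
(`hasBoundaryMeanCurvatureAt_closedBall`). This equals `λ` for exactly one admissible `r`, whatever
the dimension, which determines the radius of the ball model space (`isBallModelRadius_iff`).

For the concentration, `λ ≥ 0` ensures that for `κ > 0` the ball lies in a hemisphere, so that for
every `κ` the circumference `r/(1 + κr²/4)` is strictly increasing up to the radius of the ball. The dilation of the ball of radius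
`s < r` onto the ball of radius `r` therefore expands all lengths by a factor `K > 1`, so that the
smaller ball carries at most the fraction `K⁻ⁿ` of the volume
(`exists_pow_mul_riemVolume_closedBall_le`). The mass thus accumulates near the boundary, where an
observable is at most a constant times the Euclidean distance from the boundary, because it is
`1`-Lipschitz and vanishes there (`observable_le_of_boundary_eq_zero`, `obsInRad_ball_le`).
-/

open Set Filter Topology MeasureTheory
open scoped NNReal ENNReal

namespace BoundaryConcentration

/-! ### The radial distance function -/

/-- The Euclidean radii that occur in the conformal coordinates of the space form of
curvature `κ`. Negative numbers are included, which makes this set symmetric and open. -/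
def radialDomain (κ : ℝ) : Set ℝ := {r | 0 < 1 + κ / 4 * r ^ 2}

/-- The Riemannian distance from the origin to a point of Euclidean norm `r` in the conformal
coordinates of the space form of curvature `κ`. It is meaningful for `r` in `radialDomain κ`. -/
noncomputable def radialDist (κ r : ℝ) : ℝ := ∫ s in (0 : ℝ)..r, (1 + κ / 4 * s ^ 2)⁻¹

variable {κ r s : ℝ} {n : ℕ}

theorem isOpen_radialDomain : IsOpen (radialDomain κ) :=
  isOpen_lt continuous_const (by fun_prop)

theorem mem_radialDomain_of_abs_le (hr : r ∈ radialDomain κ) (h : |s| ≤ |r|) :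
    s ∈ radialDomain κ := by
  have h2 : s ^ 2 ≤ r ^ 2 := sq_le_sq.2 h
  simp only [radialDomain, mem_ofPred_eq] at hr ⊢
  rcases le_total 0 κ with hκ | hκ
  · positivity
  · nlinarith [mul_nonneg (neg_nonneg.2 hκ) (sub_nonneg.2 h2)]

theorem mem_radialDomain_of_le (hr : r ∈ radialDomain κ) (hs : 0 ≤ s) (h : s ≤ r) :
    s ∈ radialDomain κ :=
  mem_radialDomain_of_abs_le hr (by rwa [abs_of_nonneg hs, abs_of_nonneg (hs.trans h)])

theorem continuousOn_conformalFactor :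
    ContinuousOn (fun s : ℝ => (1 + κ / 4 * s ^ 2)⁻¹) (radialDomain κ) :=
  ContinuousOn.inv₀ (by fun_prop) fun s hs => (show 0 < 1 + κ / 4 * s ^ 2 from hs).ne'

theorem uIcc_zero_subset_radialDomain (hr : r ∈ radialDomain κ) :
    uIcc 0 r ⊆ radialDomain κ := by
  intro s hs
  refine mem_radialDomain_of_abs_le hr ?_
  simpa using abs_sub_left_of_mem_uIcc hs

theorem hasDerivAt_radialDist (hr : r ∈ radialDomain κ) :
    HasDerivAt (radialDist κ) (1 + κ / 4 * r ^ 2)⁻¹ r := by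
  refine intervalIntegral.integral_hasDerivAt_right ?_ ?_ ?_
  · exact (continuousOn_conformalFactor.mono (uIcc_zero_subset_radialDomain hr)).intervalIntegrable
  · exact continuousOn_conformalFactor.stronglyMeasurableAtFilter isOpen_radialDomain _ hr
  · exact continuousOn_conformalFactor.continuousAt (isOpen_radialDomain.mem_nhds hr)

theorem contDiffOn_radialDist : ContDiffOn ℝ 1 (radialDist κ) (radialDomain κ) := by
  rw [contDiffOn_one_iff_derivWithin isOpen_radialDomain.uniqueDiffOn]
  refine ⟨fun r hr => (hasDerivAt_radialDist hr).differentiableAt.differentiableWithinAt,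
    continuousOn_conformalFactor.congr fun r hr => ?_⟩
  rw [derivWithin_of_isOpen isOpen_radialDomain hr, (hasDerivAt_radialDist hr).deriv]

@[simp] theorem radialDist_zero : radialDist κ 0 = 0 := by simp [radialDist]

theorem radialDist_lt_radialDist (hr : r ∈ radialDomain κ) (hs : 0 ≤ s) (h : s < r) :
    radialDist κ s < radialDist κ r := by
  have hsub : Icc 0 r ⊆ radialDomain κ := fun x hx => mem_radialDomain_of_le hr hx.1 hx.2
  refine strictMonoOn_of_deriv_pos (convex_Icc 0 r)
    (contDiffOn_radialDist.continuousOn.mono hsub) (fun x hx => ?_) ⟨hs, h.le⟩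
    ⟨hs.trans h.le, le_rfl⟩ h
  have hx' := hsub (interior_subset hx)
  rw [(hasDerivAt_radialDist hx').deriv]
  exact inv_pos.2 hx'

theorem radialDist_le_radialDist_iff (hr : r ∈ radialDomain κ) (hs' : s ∈ radialDomain κ)
    (hr0 : 0 ≤ r) (hs : 0 ≤ s) : radialDist κ s ≤ radialDist κ r ↔ s ≤ r := by
  constructor
  · intro h
    by_contra! hlt
    exact (radialDist_lt_radialDist hs' hr0 hlt).not_ge h
  · intro h
    rcases h.eq_or_lt with rfl | h
    · exact le_rfl
    · exact (radialDist_lt_radialDist hr hs h).le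

theorem radialDist_pos (hr : r ∈ radialDomain κ) (h : 0 < r) : 0 < radialDist κ r := by
  simpa using radialDist_lt_radialDist hr le_rfl h

/-- The space forms of negative curvature are unbounded. -/
theorem exists_radialDist_ge (hκ : κ < 0) (R : ℝ) :
    ∃ r ∈ radialDomain κ, 0 ≤ r ∧ R ≤ radialDist κ r := by
  obtain ⟨a, ha, rfl⟩ : ∃ a : ℝ, 0 < a ∧ κ = -4 * a ^ 2 := by
    refine ⟨√(-κ / 4), Real.sqrt_pos.2 (by linarith), ?_⟩
    rw [Real.sq_sqrt (by linarith)]; ring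
  -- The integrand is at least `(1 - a s)⁻¹ / 2`, so `radialDist` dominates `-log (1 - a r) / (2a)`.
  have hmem : ∀ r, 0 ≤ r → a * r < 1 → r ∈ radialDomain (-4 * a ^ 2) := by
    intro r hr h
    have : 0 ≤ a * r := by positivity
    simp only [radialDomain, mem_ofPred_eq]
    nlinarith
  have hlow : ∀ r, 0 ≤ r → a * r < 1 →
      -Real.log (1 - a * r) / (2 * a) ≤ radialDist (-4 * a ^ 2) r := by
    intro r hr h
    have hd : ∀ x ∈ Icc 0 r, HasDerivAt
        (fun x => radialDist (-4 * a ^ 2) x - -Real.log (1 - a * x) / (2 * a))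
        ((1 + (-4 * a ^ 2) / 4 * x ^ 2)⁻¹ - (1 - a * x)⁻¹ / 2) x := by
      intro x hx
      have hx1 : a * x < 1 := (mul_le_mul_of_nonneg_left hx.2 ha.le).trans_lt h
      have h1 : HasDerivAt (fun x => 1 - a * x) (-a) x := by
        simpa using ((hasDerivAt_id x).const_mul a).const_sub 1
      have h2 := (((h1.log (by linarith)).neg).div_const (2 * a))
      refine ((hasDerivAt_radialDist (hmem x hx.1 hx1)).sub h2).congr_deriv ?_
      have : 1 - a * x ≠ 0 := by linarith
      field_simp
    have := monotoneOn_of_deriv_nonneg (convex_Icc 0 r)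
      (fun x hx => (hd x hx).continuousAt.continuousWithinAt)
      (fun x hx => (hd x (interior_subset hx)).differentiableAt.differentiableWithinAt)
      (fun x hx => ?_) ⟨le_rfl, hr⟩ ⟨hr, le_rfl⟩ hr
    · simp only [radialDist_zero, mul_zero, sub_zero, Real.log_one, neg_zero, zero_div] at this
      linarith
    · have hx' := interior_subset hx
      rw [(hd x hx').deriv]
      have hx1 : a * x < 1 := (mul_le_mul_of_nonneg_left hx'.2 ha.le).trans_lt h
      have hx0 : 0 ≤ a * x := mul_nonneg ha.le hx'.1
      have e : 1 + (-4 * a ^ 2) / 4 * x ^ 2 = (1 - a * x) * (1 + a * x) := by ring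
      rw [e, mul_inv, sub_nonneg, div_eq_mul_inv]
      refine mul_le_mul_of_nonneg_left ?_ (inv_nonneg.2 (by linarith))
      exact inv_anti₀ (by linarith) (by linarith)
  set b := Real.exp (-(2 * a * |R|)) with hb
  have hb0 : 0 < b := Real.exp_pos _
  have hb1 : b ≤ 1 := Real.exp_le_one_iff.2 (by simp only [neg_nonpos]; positivity)
  have har : a * ((1 - b) / a) = 1 - b := by field_simp
  have hr0 : 0 ≤ (1 - b) / a := div_nonneg (by linarith) ha.le
  refine ⟨(1 - b) / a, hmem _ hr0 (by linarith), hr0, (le_abs_self R).trans ?_⟩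
  refine le_of_eq_of_le ?_ (hlow _ hr0 (by linarith))
  rw [har, sub_sub_cancel, hb, Real.log_exp]
  field_simp

/-! ### Riemannian distances in the space form -/

theorem mem_spaceFormDomain {x : E n} : x ∈ spaceFormDomain κ n ↔ ‖x‖ ∈ radialDomain κ := Iff.rfl

theorem isOpen_spaceFormDomain : IsOpen (spaceFormDomain κ n) :=
  isOpen_radialDomain.preimage continuous_norm

theorem sqrt_spaceFormMetric {x : E n} (hx : x ∈ spaceFormDomain κ n) (v : E n) :
    √(spaceFormMetric κ n x v v) = (1 + κ / 4 * ‖x‖ ^ 2)⁻¹ * ‖v‖ := by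
  have h : (0 : ℝ) < 1 + κ / 4 * ‖x‖ ^ 2 := hx
  rw [spaceFormMetric, real_inner_self_eq_norm_sq, ← mul_pow, Real.sqrt_sq (by positivity)]

/-- A function whose gradient has Riemannian norm at most one is `1`-Lipschitz along curves. -/
theorem ofReal_sub_le_riemLength {f : E n → ℝ} (hf : ContDiffOn ℝ 1 f (spaceFormDomain κ n))
    (hf' : ∀ y ∈ spaceFormDomain κ n, ∀ v, |fderiv ℝ f y v| ≤ (1 + κ / 4 * ‖y‖ ^ 2)⁻¹ * ‖v‖)
    {γ : ℝ → E n} (hγ : ContDiffOn ℝ 1 γ (Icc 0 1))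
    (hm : MapsTo γ (Icc 0 1) (spaceFormDomain κ n)) :
    ENNReal.ofReal (f (γ 1) - f (γ 0)) ≤ riemLength (spaceFormMetric κ n) γ := by
  have h := enorm_sub_le_lintegral_derivWithin_Icc_of_contDiffOn_Icc (hf.comp hγ hm) zero_le_one
  refine le_trans ?_ (h.trans (setLIntegral_mono' measurableSet_Icc fun t ht => ?_))
  · rw [Real.enorm_eq_ofReal_abs]
    exact ENNReal.ofReal_le_ofReal (le_abs_self _)
  · rw [sqrt_spaceFormMetric (hm ht), Real.enorm_eq_ofReal_abs]
    refine ENNReal.ofReal_le_ofReal ?_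
    have hft := (hf.differentiableOn one_ne_zero).differentiableAt
      (isOpen_spaceFormDomain.mem_nhds (hm ht))
    have hγt := hγ.differentiableOn one_ne_zero t ht
    rw [(hft.hasFDerivAt.comp_hasDerivWithinAt t hγt.hasDerivWithinAt).derivWithin
      (uniqueDiffOn_Icc_zero_one t ht)]
    exact hf' _ (hm ht) _

theorem radialDist_le_riemLength_of_nonpos (hκ : κ ≤ 0) {γ : ℝ → E n}
    (hγ : ContDiffOn ℝ 1 γ (Icc 0 1)) (hm : MapsTo γ (Icc 0 1) (spaceFormDomain κ n))
    (h0 : γ 0 = 0) :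
    ENNReal.ofReal (radialDist κ ‖γ 1‖) ≤ riemLength (spaceFormMetric κ n) γ := by
  rcases eq_or_ne (γ 1) 0 with h1 | h1
  · simp [h1]
  -- In nonpositive curvature, projecting to the line through `γ 1` does not increase lengths.
  set u : E n := ‖γ 1‖⁻¹ • γ 1 with hu
  have hu1 : ‖u‖ = 1 := norm_smul_inv_norm (𝕜 := ℝ) h1
  have habs : ∀ y : E n, |inner ℝ u y| ≤ ‖y‖ := fun y => by
    simpa [hu1] using abs_real_inner_le_norm u y
  have hmaps : ∀ y ∈ spaceFormDomain κ n, inner ℝ u y ∈ radialDomain κ := fun y hy =>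
    mem_radialDomain_of_abs_le hy (by simpa using habs y)
  have key := ofReal_sub_le_riemLength (κ := κ) (f := fun y => radialDist κ (inner ℝ u y))
    (contDiffOn_radialDist.comp (innerSL ℝ u).contDiff.contDiffOn hmaps) (fun y hy v => ?_) hγ hm
  · have e : inner ℝ u (γ 1) = ‖γ 1‖ := by
      rw [hu, real_inner_smul_left, real_inner_self_eq_norm_sq]
      have := norm_ne_zero_iff.2 h1
      field_simp
    simpa [e, h0] using key
  · have hd : HasFDerivAt (fun y => radialDist κ (inner ℝ u y))
        ((1 + κ / 4 * (inner ℝ u y) ^ 2)⁻¹ • innerSL ℝ u) y :=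
      (hasDerivAt_radialDist (hmaps y hy)).comp_hasFDerivAt y (innerSL ℝ u).hasFDerivAt
    have hy' : (0 : ℝ) < 1 + κ / 4 * ‖y‖ ^ 2 := hy
    have hle : 1 + κ / 4 * ‖y‖ ^ 2 ≤ 1 + κ / 4 * (inner ℝ u y) ^ 2 := by
      have := sq_le_sq' (neg_le_of_abs_le (habs y)) (le_of_abs_le (habs y))
      nlinarith [mul_nonneg (neg_nonneg.2 hκ) (sub_nonneg.2 this)]
    rw [hd.fderiv]
    simp only [smul_apply, innerSL_apply_apply, smul_eq_mul, abs_mul]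
    rw [abs_of_pos (inv_pos.2 (hy'.trans_le hle))]
    exact mul_le_mul (inv_anti₀ hy' hle) (habs v) (abs_nonneg _) (inv_pos.2 hy').le

theorem radialDist_le_riemLength_of_nonneg (hκ : 0 ≤ κ) {γ : ℝ → E n}
    (hγ : ContDiffOn ℝ 1 γ (Icc 0 1)) (hm : MapsTo γ (Icc 0 1) (spaceFormDomain κ n))
    (h0 : γ 0 = 0) :
    ENNReal.ofReal (radialDist κ ‖γ 1‖) ≤ riemLength (spaceFormMetric κ n) γ := by
  have huniv : ∀ r, r ∈ radialDomain κ := fun r => by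
    simp only [radialDomain, mem_ofPred_eq]; positivity
  -- The norm is not differentiable at the origin, so it is replaced by `√(δ + ‖y‖²)`.
  have key : ∀ δ : ℝ, 0 < δ →
      ENNReal.ofReal (radialDist κ √(δ + ‖γ 1‖ ^ 2) - radialDist κ √δ) ≤
        riemLength (spaceFormMetric κ n) γ := by
    intro δ hδ
    have hpos : ∀ y : E n, 0 < δ + ‖y‖ ^ 2 := fun y => by positivity
    have := ofReal_sub_le_riemLength (κ := κ) (f := fun y => radialDist κ √(δ + ‖y‖ ^ 2))
      (contDiffOn_radialDist.comp (ContDiff.contDiffOn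
        (((contDiff_const.add (contDiff_norm_sq ℝ))).sqrt fun y => (hpos y).ne'))
        fun y _ => huniv _) (fun y hy v => ?_) hγ hm
    · simpa [h0] using this
    · have h1 : HasFDerivAt (fun y : E n => δ + ‖y‖ ^ 2) (2 • innerSL ℝ y) y :=
        (hasStrictFDerivAt_norm_sq y).hasFDerivAt.const_add δ
      have hd := (hasDerivAt_radialDist (huniv √(δ + ‖y‖ ^ 2))).comp_hasFDerivAt y
        (h1.sqrt (hpos y).ne')
      have hd' : fderiv ℝ (fun y : E n => radialDist κ √(δ + ‖y‖ ^ 2)) y = _ := hd.fderiv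
      rw [hd']
      simp only [smul_apply, innerSL_apply_apply, smul_eq_mul, abs_mul,
        nsmul_eq_mul, Nat.cast_ofNat, Real.sq_sqrt (hpos y).le]
      have hy' : (0 : ℝ) < 1 + κ / 4 * ‖y‖ ^ 2 := hy
      have hle : 1 + κ / 4 * ‖y‖ ^ 2 ≤ 1 + κ / 4 * (δ + ‖y‖ ^ 2) := by
        nlinarith [mul_nonneg hκ hδ.le]
      have hs : 0 < √(δ + ‖y‖ ^ 2) := Real.sqrt_pos.2 (hpos y)
      rw [abs_of_pos (inv_pos.2 (hy'.trans_le hle))]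
      refine mul_le_mul (inv_anti₀ hy' hle) ?_ (by positivity) (inv_pos.2 hy').le
      have hns : ‖y‖ ≤ √(δ + ‖y‖ ^ 2) := Real.le_sqrt_of_sq_le (by linarith)
      rw [abs_of_pos (by positivity : 0 < 1 / (2 * √(δ + ‖y‖ ^ 2)))]
      rw [abs_two, one_div_mul_eq_div, mul_div_mul_left _ _ two_ne_zero,
        div_le_iff₀ hs]
      calc |inner ℝ y v| ≤ ‖y‖ * ‖v‖ := abs_real_inner_le_norm y v
        _ ≤ ‖v‖ * √(δ + ‖y‖ ^ 2) := by
          rw [mul_comm]; exact mul_le_mul_of_nonneg_left hns (norm_nonneg v)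
  have hcont : Continuous (radialDist κ) := continuous_iff_continuousAt.2 fun r =>
    (hasDerivAt_radialDist (huniv r)).continuousAt
  have hlim : Tendsto (fun δ : ℝ =>
      ENNReal.ofReal (radialDist κ √(δ + ‖γ 1‖ ^ 2) - radialDist κ √δ)) (𝓝[>] 0)
      (𝓝 (ENNReal.ofReal (radialDist κ √(0 + ‖γ 1‖ ^ 2) - radialDist κ √0))) := by
    refine Tendsto.mono_left ?_ nhdsWithin_le_nhds
    exact (ENNReal.continuous_ofReal.comp (by fun_prop : Continuous fun δ : ℝ =>
      radialDist κ √(δ + ‖γ 1‖ ^ 2) - radialDist κ √δ)).tendsto 0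
  have hle := le_of_tendsto hlim (eventually_mem_nhdsWithin.mono key)
  simpa [Real.sqrt_sq (norm_nonneg _)] using hle

theorem riemLength_segment_le {x y : E n} {M : ℝ}
    (hM : ∀ z ∈ segment ℝ x y, z ∈ spaceFormDomain κ n ∧ (1 + κ / 4 * ‖z‖ ^ 2)⁻¹ ≤ M) :
    riemLength (spaceFormMetric κ n) (AffineMap.lineMap x y : ℝ → E n) ≤
      ENNReal.ofReal (M * ‖y - x‖) := by
  calc riemLength (spaceFormMetric κ n) (AffineMap.lineMap x y : ℝ → E n)
      ≤ ∫⁻ _ in Icc (0 : ℝ) 1, ENNReal.ofReal (M * ‖y - x‖) := by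
        refine setLIntegral_mono' measurableSet_Icc fun t ht => ?_
        obtain ⟨h1, h2⟩ := hM (AffineMap.lineMap x y t) (by
          rw [segment_eq_image_lineMap]; exact mem_image_of_mem _ ht)
        rw [AffineMap.hasDerivWithinAt_lineMap.derivWithin (uniqueDiffOn_Icc_zero_one t ht),
          sqrt_spaceFormMetric h1]
        gcongr
    _ = ENNReal.ofReal (M * ‖y - x‖) := by simp

theorem contDiff_lineMap (x y : E n) : ContDiff ℝ 1 (AffineMap.lineMap x y : ℝ → E n) := by
  simp only [AffineMap.coe_lineMap, vsub_eq_sub, vadd_eq_add]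
  fun_prop

theorem riemEDist_zero_le {x : E n} (hx : x ∈ spaceFormDomain κ n) :
    riemEDist (spaceFormMetric κ n) (spaceFormDomain κ n) 0 x ≤
      ENNReal.ofReal (radialDist κ ‖x‖) := by
  have hnorm : ∀ t ∈ Icc (0 : ℝ) 1, ‖AffineMap.lineMap (0 : E n) x t‖ = t * ‖x‖ := fun t ht => by
    simp [AffineMap.lineMap_apply, norm_smul, abs_of_nonneg ht.1]
  have hdom : ∀ t ∈ Icc (0 : ℝ) 1, t * ‖x‖ ∈ radialDomain κ := fun t ht =>
    mem_radialDomain_of_le hx (mul_nonneg ht.1 (norm_nonneg x))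
      (mul_le_of_le_one_left (norm_nonneg x) ht.2)
  have hm : MapsTo (AffineMap.lineMap (0 : E n) x : ℝ → E n) (Icc 0 1) (spaceFormDomain κ n) :=
    fun t ht => by rw [mem_spaceFormDomain, hnorm t ht]; exact hdom t ht
  refine iInf₂_le_of_le _ ⟨(contDiff_lineMap 0 x).contDiffOn, hm, by simp, by simp⟩ (le_of_eq ?_)
  have hc : ContinuousOn (fun t : ℝ => (1 + κ / 4 * (t * ‖x‖) ^ 2)⁻¹ * ‖x‖) (Icc 0 1) :=
    (continuousOn_conformalFactor.comp (f := fun t : ℝ => t * ‖x‖) (by fun_prop) hdom).mul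
      continuousOn_const
  calc riemLength (spaceFormMetric κ n) (AffineMap.lineMap (0 : E n) x : ℝ → E n)
      = ∫⁻ t in Icc (0 : ℝ) 1, ENNReal.ofReal ((1 + κ / 4 * (t * ‖x‖) ^ 2)⁻¹ * ‖x‖) := by
        refine setLIntegral_congr_fun measurableSet_Icc fun t ht => ?_
        simp only [AffineMap.hasDerivWithinAt_lineMap.derivWithin (uniqueDiffOn_Icc_zero_one t ht),
          sqrt_spaceFormMetric (hm ht), hnorm t ht, sub_zero]
    _ = ENNReal.ofReal (∫ t in Icc (0 : ℝ) 1, (1 + κ / 4 * (t * ‖x‖) ^ 2)⁻¹ * ‖x‖) := by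
        refine (ofReal_integral_eq_lintegral_ofReal (hc.integrableOn_Icc) ?_).symm
        refine (ae_restrict_iff' measurableSet_Icc).2 (.of_forall fun t ht => ?_)
        exact mul_nonneg (inv_nonneg.2 (le_of_lt (hdom t ht))) (norm_nonneg x)
    _ = ENNReal.ofReal (radialDist κ ‖x‖) := by
        rw [integral_Icc_eq_integral_Ioc, ← intervalIntegral.integral_of_le zero_le_one,
          intervalIntegral.integral_mul_const, mul_comm,
          intervalIntegral.mul_integral_comp_mul_right (f := fun s => (1 + κ / 4 * s ^ 2)⁻¹)]
        simp [radialDist]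

/-- In conformal coordinates, the Riemannian distance from the origin is the radial distance. -/
theorem riemEDist_zero {x : E n} (hx : x ∈ spaceFormDomain κ n) :
    riemEDist (spaceFormMetric κ n) (spaceFormDomain κ n) 0 x =
      ENNReal.ofReal (radialDist κ ‖x‖) := by
  refine (riemEDist_zero_le hx).antisymm (le_iInf₂ ?_)
  rintro γ ⟨hγ, hm, h0, rfl⟩
  rcases le_total κ 0 with hκ | hκ
  · exact radialDist_le_riemLength_of_nonpos hκ hγ hm h0
  · exact radialDist_le_riemLength_of_nonneg hκ hγ hm h0

/-! ### Geodesic balls are Euclidean balls -/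

theorem mem_spaceFormBall {R : ℝ} (hR : 0 ≤ R) {x : E n} :
    x ∈ spaceFormBall κ n R ↔ x ∈ spaceFormDomain κ n ∧ radialDist κ ‖x‖ ≤ R := by
  refine and_congr_right fun hx => ?_
  rw [riemEDist_zero hx, ENNReal.ofReal_le_ofReal_iff hR]

theorem spaceFormBall_radialDist (hr : r ∈ radialDomain κ) (h0 : 0 < r) :
    spaceFormBall κ n (radialDist κ r) = Metric.closedBall 0 r := by
  ext x
  rw [mem_spaceFormBall (radialDist_pos hr h0).le, mem_closedBall_zero_iff, mem_spaceFormDomain]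
  constructor
  · rintro ⟨hx, h⟩
    exact (radialDist_le_radialDist_iff hr hx h0.le (norm_nonneg x)).1 h
  · intro h
    have hx := mem_radialDomain_of_le hr (norm_nonneg x) h
    exact ⟨hx, (radialDist_le_radialDist_iff hr hx h0.le (norm_nonneg x)).2 h⟩

/-- A ball with nonempty boundary has a radius of the form `radialDist κ r`: otherwise the ball is
the whole space form. -/
theorem exists_radialDist_eq_of_frontier_nonempty {R : ℝ} (hR : 0 < R)
    (hne : (frontier (spaceFormBall κ n R)).Nonempty) :
    ∃ r ∈ radialDomain κ, 0 < r ∧ radialDist κ r = R := by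
  by_cases H : ∃ r ∈ radialDomain κ, 0 ≤ r ∧ R ≤ radialDist κ r
  · obtain ⟨r, hr, h0, hRr⟩ := H
    have hsub : Icc 0 r ⊆ radialDomain κ := fun x hx => mem_radialDomain_of_le hr hx.1 hx.2
    obtain ⟨s, hs, rfl⟩ := intermediate_value_Icc h0
      (contDiffOn_radialDist.continuousOn.mono hsub) ⟨radialDist_zero.trans_le hR.le, hRr⟩
    refine ⟨s, hsub hs, hs.1.lt_of_ne ?_, rfl⟩
    rintro rfl
    simp at hR
  · have hκ : 0 ≤ κ := by
      by_contra! hκ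
      exact H (exists_radialDist_ge hκ R)
    push Not at H
    have : spaceFormBall κ n R = univ := by
      refine eq_univ_of_forall fun x => (mem_spaceFormBall hR.le).2 ?_
      have hx : x ∈ spaceFormDomain κ n := by
        simp only [spaceFormDomain, mem_ofPred_eq]; positivity
      exact ⟨hx, (H _ hx (norm_nonneg x)).le⟩
    simp [this] at hne

/-! ### The Levi-Civita connection of the space form -/

theorem inner_e (i : Fin n) (x : E n) : inner ℝ x (e i) = x i := by
  simp [e, EuclideanSpace.inner_single_right]

theorem gram_spaceFormMetric (x : E n) :
    gram (spaceFormMetric κ n) x =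
      (((1 + κ / 4 * ‖x‖ ^ 2)⁻¹) ^ 2) • (1 : Matrix (Fin n) (Fin n) ℝ) := by
  ext i j
  simp only [gram, spaceFormMetric, Matrix.of_apply, Matrix.smul_apply, smul_eq_mul, inner_e]
  simp [e, Matrix.one_apply, eq_comm]

theorem partialD_gram_spaceFormMetric {x : E n} (hx : x ∈ spaceFormDomain κ n) (i j l : Fin n) :
    partialD i (fun y => gram (spaceFormMetric κ n) y j l) x =
      -κ * ((1 + κ / 4 * ‖x‖ ^ 2)⁻¹) ^ 3 * x i * if j = l then 1 else 0 := by
  have hx' : (0 : ℝ) < 1 + κ / 4 * ‖x‖ ^ 2 := hx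
  have h1 : HasFDerivAt (fun y : E n => 1 + κ / 4 * ‖y‖ ^ 2) ((κ / 4) • 2 • innerSL ℝ x) x :=
    ((hasStrictFDerivAt_norm_sq x).hasFDerivAt.const_mul (κ / 4)).const_add 1
  have h2 := (((hasDerivAt_inv hx'.ne').comp_hasFDerivAt x h1).pow 2).mul_const
    (if j = l then (1 : ℝ) else 0)
  have h3 : (fun y => gram (spaceFormMetric κ n) y j l) = fun y =>
      ((1 + κ / 4 * ‖y‖ ^ 2)⁻¹) ^ 2 * if j = l then (1 : ℝ) else 0 := by
    funext y
    rw [gram_spaceFormMetric, Matrix.smul_apply, Matrix.one_apply, smul_eq_mul]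
  have h4 : fderiv ℝ (fun y : E n => ((1 + κ / 4 * ‖y‖ ^ 2)⁻¹) ^ 2 * if j = l then (1 : ℝ) else 0)
      x = _ := HasFDerivAt.fderiv h2
  rw [partialD, h3, h4]
  simp only [smul_apply, smul_eq_mul, nsmul_eq_mul, innerSL_apply_apply, inner_e]
  split_ifs
  · simp only [Function.comp_apply]
    generalize 1 + κ / 4 * ‖x‖ ^ 2 = p
    norm_num
    ring
  · simp

theorem christoffel_spaceFormMetric {x : E n} (hx : x ∈ spaceFormDomain κ n) (k i j : Fin n) :
    christoffel (spaceFormMetric κ n) x k i j =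
      -(κ / 2 * (1 + κ / 4 * ‖x‖ ^ 2)⁻¹) *
        ((x i * if j = k then 1 else 0) + (x j * if i = k then 1 else 0)
          - x k * if i = j then 1 else 0) := by
  have hx' : (0 : ℝ) < 1 + κ / 4 * ‖x‖ ^ 2 := hx
  have hinv : (gram (spaceFormMetric κ n) x)⁻¹ =
      ((1 + κ / 4 * ‖x‖ ^ 2) ^ 2) • (1 : Matrix (Fin n) (Fin n) ℝ) := by
    refine Matrix.inv_eq_right_inv ?_
    rw [gram_spaceFormMetric, smul_mul_smul_comm, ← mul_pow, inv_mul_cancel₀ hx'.ne']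
    simp
  simp only [christoffel, partialD_gram_spaceFormMetric hx, hinv, Matrix.smul_apply,
    Matrix.one_apply, smul_eq_mul]
  rw [Finset.sum_eq_single k (fun l _ hl => by simp [hl.symm]) (by simp)]
  simp only [if_true]
  field_simp
  ring

/-- The Levi-Civita connection of the conformal metric: the correction to the Euclidean derivative
is determined by the gradient of the logarithm of the conformal factor. -/
theorem covDeriv_spaceFormMetric {x : E n} (hx : x ∈ spaceFormDomain κ n) (u : E n)
    (V : E n → E n) :
    covDeriv (spaceFormMetric κ n) u V x =
      fderiv ℝ V x u - (κ / 2 * (1 + κ / 4 * ‖x‖ ^ 2)⁻¹) •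
        (inner ℝ x u • V x + inner ℝ x (V x) • u - inner ℝ u (V x) • x) := by
  rw [covDeriv, sub_eq_add_neg]
  congr 1
  ext k
  have hin : ∀ a b : E n, inner ℝ a b = ∑ i, a i * b i := fun a b => by
    simp [PiLp.inner_apply, mul_comm]
  simp only [christoffel_spaceFormMetric hx]
  generalize κ / 2 * (1 + κ / 4 * ‖x‖ ^ 2)⁻¹ = a
  have h : ∀ i j, -a * ((x i * if j = k then 1 else 0) + (x j * if i = k then 1 else 0)
      - x k * if i = j then 1 else 0) * u i * V x j =
      -a * ((x i * u i) * (if j = k then V x j else 0) + (if i = k then u i else 0) * (x j * V x j)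
        - x k * if i = j then u i * V x j else 0) := by
    intro i j
    split_ifs <;> ring
  have hL : (∑ k, (∑ i, ∑ j, -a * ((x i * if j = k then 1 else 0) + (x j * if i = k then 1 else 0)
      - x k * if i = j then 1 else 0) * u i * V x j) • (e k : E n)) k = (∑ i, ∑ j,
      -a * ((x i * if j = k then 1 else 0) + (x j * if i = k then 1 else 0)
      - x k * if i = j then 1 else 0) * u i * V x j) := by
    simp [e, Pi.single_apply]
  rw [hL]
  simp only [h, ← Finset.mul_sum, Finset.sum_sub_distrib, Finset.sum_add_distrib,
    Finset.sum_ite_eq, Finset.sum_ite_eq', Finset.mem_univ, if_true, ← Finset.sum_mul]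
  simp only [hin, PiLp.neg_apply, PiLp.smul_apply, PiLp.sub_apply, PiLp.add_apply, smul_eq_mul]
  ring

/-! ### The mean curvature of round spheres -/

theorem isTangentTo_sphere (h0 : 0 < r) {z v : E n} (hz : ‖z‖ = r) :
    IsTangentTo (Metric.sphere 0 r) z v ↔ inner ℝ z v = 0 := by
  constructor
  · rintro ⟨γ, hγ0, hγ, hS⟩
    have h1 := hγ.norm_sq
    have h2 : (fun t => ‖γ t‖ ^ 2) =ᶠ[𝓝 0] fun _ => r ^ 2 :=
      hS.mono fun t ht => by simp only [mem_sphere_zero_iff_norm.1 ht]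
    have := h1.unique ((hasDerivAt_const (0 : ℝ) (r ^ 2)).congr_of_eventuallyEq h2)
    rw [hγ0] at this
    linarith
  · intro h
    set k : ℝ := ‖v‖ ^ 2 / r ^ 2 with hk
    have hpos : ∀ t : ℝ, 0 < 1 + k * t ^ 2 := fun t => by positivity
    -- The tangent curve is the line `z + t v`, projected to the sphere
    refine ⟨fun t => (√(1 + k * t ^ 2))⁻¹ • (z + t • v), by simp, ?_, .of_forall fun t => ?_⟩
    · have h1 : HasDerivAt (fun t : ℝ => 1 + k * t ^ 2) 0 0 := by
        simpa using ((hasDerivAt_pow 2 (0 : ℝ)).const_mul k).const_add 1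
      have h2 := (h1.sqrt (hpos 0).ne').fun_inv (Real.sqrt_pos.2 (hpos 0)).ne'
      have h3 : HasDerivAt (fun t : ℝ => z + t • v) v 0 := by
        simpa using ((hasDerivAt_id (0 : ℝ)).smul_const v).const_add z
      simpa using h2.fun_smul h3
    · have hsq : ‖z + t • v‖ ^ 2 = r ^ 2 * (1 + k * t ^ 2) := by
        rw [norm_add_sq_real, real_inner_smul_right, h, norm_smul, hz, mul_pow, Real.norm_eq_abs,
          sq_abs, hk]
        field_simp
        ring
      rw [mem_sphere_zero_iff_norm, norm_smul, norm_inv, Real.norm_of_nonneg (Real.sqrt_nonneg _),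
        ← Real.sqrt_sq (norm_nonneg (z + t • v)), hsq, Real.sqrt_mul (sq_nonneg r),
        Real.sqrt_sq h0.le]
      have := (Real.sqrt_pos.2 (hpos t)).ne'
      field_simp

theorem frontier_closedBall_zero (h0 : 0 < r) :
    frontier (Metric.closedBall (0 : E n) r) = Metric.sphere 0 r :=
  frontier_closedBall _ h0.ne'

/-- The unit inner normal of a round ball is the radial vector field. -/
theorem eq_radial_of_isInnerUnitNormalOn (hr : r ∈ radialDomain κ) (h0 : 0 < r) {W : Set (E n)}
    {ν : E n → E n} (hν : IsInnerUnitNormalOn (spaceFormMetric κ n) (Metric.closedBall 0 r) W ν)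
    {y : E n} (hyW : y ∈ W) (hy : ‖y‖ = r) : ν y = (-((1 + κ / 4 * r ^ 2) / r)) • y := by
  have hp : 0 < 1 + κ / 4 * r ^ 2 := hr
  have hyF : y ∈ W ∩ frontier (Metric.closedBall 0 r) := by
    rw [frontier_closedBall_zero h0]; exact ⟨hyW, by simpa using hy⟩
  set a : ℝ := inner ℝ y (ν y) / r ^ 2 with ha
  have hpar : ν y = a • y := by
    have hperp : inner ℝ y (ν y - a • y) = 0 := by
      rw [inner_sub_right, real_inner_smul_right, real_inner_self_eq_norm_sq, hy, ha]
      field_simp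
      ring
    have hn := hν.normal y hyF (ν y - a • y) (by
      rw [frontier_closedBall_zero h0, isTangentTo_sphere h0 hy]; exact hperp)
    rw [spaceFormMetric, hy, mul_eq_zero] at hn
    have hn' := hn.resolve_left (by positivity)
    have : inner ℝ (ν y - a • y) (ν y - a • y) = 0 := by
      rw [inner_sub_left, hn', real_inner_smul_left, hperp]; simp
    exact sub_eq_zero.1 (inner_self_eq_zero.1 this)
  have hunit := hν.unit y hyF
  rw [hpar, spaceFormMetric, real_inner_smul_left, real_inner_smul_right,
    real_inner_self_eq_norm_sq, hy] at hunit
  have ha0 : a ≤ 0 := by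
    obtain ⟨t, ht, ht0⟩ := ((hν.inner y hyF).and self_mem_nhdsWithin).exists
    have ht0 : 0 < t := ht0
    rw [hpar, mem_closedBall_zero_iff, smul_smul, ← one_smul ℝ y, smul_smul, ← add_smul, norm_smul,
      hy, Real.norm_eq_abs, mul_one] at ht
    by_contra! hpos
    have : 0 < t * a := mul_pos ht0 hpos
    have h1 := mul_le_mul_of_nonneg_right (le_abs_self (1 + t * a)) h0.le
    nlinarith
  have hsq : (-a * r) ^ 2 = (1 + κ / 4 * r ^ 2) ^ 2 := by
    have h1 : (1 + κ / 4 * r ^ 2) ^ 2 * ((1 + κ / 4 * r ^ 2)⁻¹) ^ 2 = 1 := by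
      rw [← mul_pow, mul_inv_cancel₀ hp.ne', one_pow]
    linear_combination (1 + κ / 4 * r ^ 2) ^ 2 * hunit - a ^ 2 * r ^ 2 * h1
  have := (sq_eq_sq₀ (mul_nonneg (neg_nonneg.2 ha0) h0.le) hp.le).1 hsq
  rw [hpar]
  congr 1
  rw [← this]
  field_simp

theorem covDeriv_radial (hr : r ∈ radialDomain κ) (h0 : 0 < r) {ν : E n → E n} {z u : E n}
    (hz : ‖z‖ = r) (hu : inner ℝ z u = 0) (hνz : ν z = (-((1 + κ / 4 * r ^ 2) / r)) • z)
    (hd : fderiv ℝ ν z u = (-((1 + κ / 4 * r ^ 2) / r)) • u) :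
    -covDeriv (spaceFormMetric κ n) u ν z = ((1 - κ / 4 * r ^ 2) / r) • u := by
  have hp : 0 < 1 + κ / 4 * r ^ 2 := hr
  rw [covDeriv_spaceFormMetric (by rwa [mem_spaceFormDomain, hz]), hd, hνz, hz, hu,
    real_inner_smul_right, real_inner_smul_right, real_inner_comm z u, hu, real_inner_self_eq_norm_sq,
    hz, zero_smul, mul_zero, zero_smul, zero_add, sub_zero, smul_smul, ← sub_smul, ← neg_smul]
  congr 1
  generalize hq : 1 + κ / 4 * r ^ 2 = p at hp
  field_simp
  linarith

/-- The mean curvature of the sphere of Euclidean radius `r` in conformal coordinates. -/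
theorem hasBoundaryMeanCurvatureAt_closedBall (hr : r ∈ radialDomain κ) (h0 : 0 < r) {z : E n}
    (hz : ‖z‖ = r) (h : ℝ) :
    HasBoundaryMeanCurvatureAt (spaceFormMetric κ n) (Metric.closedBall 0 r) z h ↔
      h = ((n : ℝ) - 1) * ((1 - κ / 4 * r ^ 2) / r) := by
  have hp : 0 < 1 + κ / 4 * r ^ 2 := hr
  have hz0 : z ≠ 0 := norm_ne_zero_iff.1 (hz ▸ h0.ne')
  obtain ⟨m, rfl⟩ : ∃ m, n = m + 1 := by
    refine Nat.exists_eq_succ_of_ne_zero ?_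
    rintro rfl
    exact hz0 (Subsingleton.elim _ _)
  -- Each vector of an orthonormal tangent frame contributes one principal curvature to the trace.
  have htrace : ∀ (ν : E (m + 1) → E (m + 1)) (b : Fin (m + 1 - 1) → E (m + 1)),
      (∀ i, -covDeriv (spaceFormMetric κ (m + 1)) (b i) ν z = ((1 - κ / 4 * r ^ 2) / r) • b i) →
      (∀ i j, spaceFormMetric κ (m + 1) z (b i) (b j) = if i = j then 1 else 0) →
      ∑ i, spaceFormMetric κ (m + 1) z (-covDeriv (spaceFormMetric κ (m + 1)) (b i) ν z) (b i) =
        (((m + 1 : ℕ) : ℝ) - 1) * ((1 - κ / 4 * r ^ 2) / r) := by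
    intro ν b hA hb
    have : ∀ i, spaceFormMetric κ (m + 1) z
        (-covDeriv (spaceFormMetric κ (m + 1)) (b i) ν z) (b i) = (1 - κ / 4 * r ^ 2) / r := by
      intro i
      have hbi := hb i i
      rw [if_pos rfl, spaceFormMetric] at hbi
      rw [hA, spaceFormMetric, real_inner_smul_left, mul_left_comm, hbi, mul_one]
    simp [this]
  constructor
  · rintro ⟨W, ν, hW, hzW, hν, b, hbt, hb, rfl⟩
    refine htrace ν b (fun i => ?_) hb
    rw [frontier_closedBall_zero h0] at hbt
    refine covDeriv_radial hr h0 hz ((isTangentTo_sphere h0 hz).1 (hbt i))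
      (eq_radial_of_isInnerUnitNormalOn hr h0 hν hzW hz) ?_
    -- `ν` is only known on the sphere, so its derivative is computed along a curve in the sphere.
    obtain ⟨γ, hγ0, hγ, hS⟩ := hbt i
    have hνd : HasFDerivAt ν (fderiv ℝ ν z) (γ 0) := by
      rw [hγ0]
      exact ((hν.contDiffOn.differentiableOn one_ne_zero).differentiableAt
        (hW.mem_nhds hzW)).hasFDerivAt
    have hWev : ∀ᶠ t in 𝓝 0, γ t ∈ W :=
      hγ.continuousAt.eventually_mem (hW.mem_nhds (by rwa [hγ0]))
    have heq : ν ∘ γ =ᶠ[𝓝 0] fun t => (-((1 + κ / 4 * r ^ 2) / r)) • γ t :=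
      (hS.and hWev).mono fun t ht =>
        eq_radial_of_isInnerUnitNormalOn hr h0 hν ht.2 (mem_sphere_zero_iff_norm.1 ht.1)
    exact (hνd.comp_hasDerivAt 0 hγ).unique
      ((hγ.const_smul (-((1 + κ / 4 * r ^ 2) / r))).congr_of_eventuallyEq heq)
  · rintro rfl
    have : Fact (Module.finrank ℝ (E (m + 1)) = m + 1) := ⟨by simp⟩
    let b₀ := OrthonormalBasis.fromOrthogonalSpanSingleton (𝕜 := ℝ) m hz0
    let b : Fin (m + 1 - 1) → E (m + 1) := fun i => (1 + κ / 4 * r ^ 2) • (b₀ i : E (m + 1))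
    let L : E (m + 1) →L[ℝ] E (m + 1) :=
      (-((1 + κ / 4 * r ^ 2) / r)) • ContinuousLinearMap.id ℝ (E (m + 1))
    have hL : ∀ y, L y = (-((1 + κ / 4 * r ^ 2) / r)) • y := fun y => rfl
    have hbz : ∀ i, inner ℝ z (b i) = 0 := fun i => by
      rw [real_inner_smul_right, Submodule.mem_orthogonal_singleton_iff_inner_right.1 (b₀ i).2,
        mul_zero]
    have hb : ∀ i j, spaceFormMetric κ (m + 1) z (b i) (b j) = if i = j then 1 else 0 := by
      intro i j
      rw [spaceFormMetric, real_inner_smul_left, real_inner_smul_right, hz,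
        ← Submodule.coe_inner, b₀.inner_eq_ite]
      generalize 1 + κ / 4 * r ^ 2 = p at hp
      field_simp
    refine ⟨univ, L, isOpen_univ, mem_univ z, ⟨L.contDiff.contDiffOn, ?_, ?_, ?_⟩, b, ?_, hb,
      (htrace L b (fun i => covDeriv_radial hr h0 hz (hbz i) (hL z) ?_) hb).symm⟩
    · rintro y ⟨-, hy⟩
      rw [frontier_closedBall_zero h0, mem_sphere_zero_iff_norm] at hy
      rw [hL, spaceFormMetric, real_inner_smul_left, real_inner_smul_right,
        real_inner_self_eq_norm_sq, hy]
      generalize 1 + κ / 4 * r ^ 2 = p at hp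
      field_simp
    · rintro y ⟨-, hy⟩ v hv
      rw [frontier_closedBall_zero h0] at hy hv
      rw [hL, spaceFormMetric, real_inner_smul_left,
        (isTangentTo_sphere h0 (mem_sphere_zero_iff_norm.1 hy)).1 hv, mul_zero, mul_zero]
    · rintro y ⟨-, hy⟩
      rw [frontier_closedBall_zero h0, mem_sphere_zero_iff_norm] at hy
      have hlt : (0 : ℝ) < r / (1 + κ / 4 * r ^ 2) := by positivity
      filter_upwards [Ioo_mem_nhdsGT hlt] with t ht
      have h1 : t * ((1 + κ / 4 * r ^ 2) / r) < 1 := by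
        have := (lt_div_iff₀ hp).1 ht.2
        rw [← mul_div_assoc, div_lt_one h0]
        exact this
      have h2 : 0 < t * ((1 + κ / 4 * r ^ 2) / r) := mul_pos ht.1 (by positivity)
      have e : y + t • L y = (1 - t * ((1 + κ / 4 * r ^ 2) / r)) • y := by
        rw [hL, sub_smul, one_smul, smul_smul, mul_neg, neg_smul, sub_eq_add_neg]
      rw [e, mem_closedBall_zero_iff, norm_smul, hy, Real.norm_eq_abs, abs_of_nonneg (by linarith)]
      nlinarith
    · intro i
      rw [frontier_closedBall_zero h0]
      exact (isTangentTo_sphere h0 hz).2 (hbz i)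
    · rw [L.fderiv, hL]

/-! ### The radius of the ball model space -/

/-- The Euclidean radius, in conformal coordinates, of the ball whose boundary has principal
curvatures `lam`: the positive root of `lam * r + κ / 4 * r ^ 2 = 1`. -/
noncomputable def modelRadius (κ lam : ℝ) : ℝ := 2 / (lam + √(lam ^ 2 + κ))

variable {lam : ℝ}

theorem ConvexBallCondition.sq_add_pos (h : ConvexBallCondition κ lam) : 0 < lam ^ 2 + κ := by
  obtain ⟨h | ⟨rfl, h⟩ | ⟨hκ, h⟩, h0⟩ := h
  · positivity
  · positivity
  · have := Real.lt_sq_of_sqrt_lt h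
    rw [abs_of_neg hκ] at this
    linarith

theorem ConvexBallCondition.modelRadius_pos (h : ConvexBallCondition κ lam) :
    0 < modelRadius κ lam :=
  div_pos two_pos (add_pos_of_nonneg_of_pos h.2 (Real.sqrt_pos.2 h.sq_add_pos))

theorem ConvexBallCondition.modelRadius_root (h : ConvexBallCondition κ lam) :
    lam * modelRadius κ lam + κ / 4 * modelRadius κ lam ^ 2 = 1 := by
  have hS := Real.sqrt_pos.2 h.sq_add_pos
  have hκ : κ = √(lam ^ 2 + κ) ^ 2 - lam ^ 2 := by rw [Real.sq_sqrt h.sq_add_pos.le]; ring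
  have hlam := h.2
  rw [modelRadius]
  set S := √(lam ^ 2 + κ)
  rw [hκ]
  field_simp
  ring

theorem ConvexBallCondition.modelRadius_mem (h : ConvexBallCondition κ lam) :
    modelRadius κ lam ∈ radialDomain κ := by
  have hS := Real.sqrt_pos.2 h.sq_add_pos
  have hlam := h.2
  have h1 : lam * modelRadius κ lam < 2 := by
    rw [modelRadius, mul_div_assoc', div_lt_iff₀ (by positivity)]
    linarith
  have := h.modelRadius_root
  simp only [radialDomain, mem_ofPred_eq]
  linarith

theorem ConvexBallCondition.eq_modelRadius (h : ConvexBallCondition κ lam)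
    (hr : r ∈ radialDomain κ) (h0 : 0 < r) (hroot : lam * r + κ / 4 * r ^ 2 = 1) :
    r = modelRadius κ lam := by
  have hs := h.modelRadius_mem
  have hs0 := h.modelRadius_pos
  have hsr := h.modelRadius_root
  set s := modelRadius κ lam
  have hr' : 0 < 1 + κ / 4 * r ^ 2 := hr
  have hs' : 0 < 1 + κ / 4 * s ^ 2 := hs
  have hprod : (r - s) * (1 + κ / 4 * (r * s)) = 0 := by linear_combination s * hroot - r * hsr
  refine sub_eq_zero.1 ((mul_eq_zero.1 hprod).resolve_right fun h => ?_)
  -- `κ r s = -4` is impossible, as `κ r² > -4` and `κ s² > -4`.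
  have hκ : κ < 0 := by
    by_contra! hκ
    have : 0 ≤ κ / 4 * (r * s) := by positivity
    linarith
  nlinarith [mul_nonneg (neg_nonneg.2 hκ.le) (sq_nonneg (r - s))]

theorem isBallModelRadius_iff (h : ConvexBallCondition κ lam) (hn : 2 ≤ n) (R : ℝ) :
    IsBallModelRadius κ lam n R ↔ R = radialDist κ (modelRadius κ lam) := by
  have hn1 : (0 : ℝ) < (n : ℝ) - 1 := by
    have : (2 : ℝ) ≤ n := by exact_mod_cast hn
    linarith
  constructor
  · rintro ⟨hR, ⟨z, hz⟩, hH⟩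
    obtain ⟨r, hr, h0, rfl⟩ := exists_radialDist_eq_of_frontier_nonempty hR ⟨z, hz⟩
    specialize hH z hz
    rw [spaceFormBall_radialDist hr h0] at hz hH
    rw [frontier_closedBall_zero h0, mem_sphere_zero_iff_norm] at hz
    rw [hasBoundaryMeanCurvatureAt_closedBall hr h0 hz] at hH
    have hlam := mul_left_cancel₀ hn1.ne' hH
    rw [← h.eq_modelRadius hr h0 ?_]
    rw [hlam]
    field_simp
    ring
  · rintro rfl
    have hr := h.modelRadius_mem
    have h0 := h.modelRadius_pos
    have : Nonempty (Fin n) := ⟨⟨0, by lia⟩⟩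
    refine ⟨radialDist_pos hr h0, ?_, fun z hz => ?_⟩
    · rw [spaceFormBall_radialDist hr h0, frontier_closedBall_zero h0]
      exact NormedSpace.sphere_nonempty.2 h0.le
    · rw [spaceFormBall_radialDist hr h0] at hz ⊢
      rw [frontier_closedBall_zero h0, mem_sphere_zero_iff_norm] at hz
      rw [hasBoundaryMeanCurvatureAt_closedBall hr h0 hz]
      congr 1
      rw [eq_div_iff h0.ne']
      linarith [h.modelRadius_root]

variable {R δ : ℝ}

/-! ### The volume of concentric balls -/

theorem sqrt_det_gram_spaceFormMetric {x : E n} (hx : x ∈ spaceFormDomain κ n) :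
    √(gram (spaceFormMetric κ n) x).det = ((1 + κ / 4 * ‖x‖ ^ 2)⁻¹) ^ n := by
  have hx' : (0 : ℝ) < 1 + κ / 4 * ‖x‖ ^ 2 := hx
  rw [gram_spaceFormMetric, Matrix.det_smul, Matrix.det_one, mul_one, Fintype.card_fin, ← pow_mul,
    mul_comm 2 n, pow_mul, Real.sqrt_sq (by positivity)]

theorem closedBall_subset_spaceFormDomain (hr : r ∈ radialDomain κ) :
    Metric.closedBall 0 r ⊆ spaceFormDomain κ n := fun x hx =>
  mem_radialDomain_of_le hr (norm_nonneg x) (mem_closedBall_zero_iff.1 hx)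

theorem riemVolume_closedBall (hr : r ∈ radialDomain κ) :
    riemVolume (spaceFormMetric κ n) (Metric.closedBall 0 r) =
      ∫⁻ x in Metric.closedBall (0 : E n) r, ENNReal.ofReal (((1 + κ / 4 * ‖x‖ ^ 2)⁻¹) ^ n) := by
  rw [riemVolume, withDensity_apply _ Metric.isClosed_closedBall.measurableSet]
  refine setLIntegral_congr_fun Metric.isClosed_closedBall.measurableSet fun x hx => ?_
  simp only [sqrt_det_gram_spaceFormMetric (closedBall_subset_spaceFormDomain hr hx)]

/-- An upper bound for the conformal factor on the closed ball of Euclidean radius `r`. -/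
noncomputable def factorBound (κ r : ℝ) : ℝ := (min 1 (1 + κ / 4 * r ^ 2))⁻¹

theorem factorBound_pos (hr : r ∈ radialDomain κ) : 0 < factorBound κ r :=
  inv_pos.2 (lt_min one_pos hr)

theorem conformalFactor_le_factorBound (hr : r ∈ radialDomain κ) (hs : 0 ≤ s) (hsr : s ≤ r) :
    (1 + κ / 4 * s ^ 2)⁻¹ ≤ factorBound κ r := by
  refine inv_anti₀ (lt_min one_pos hr) ?_
  rcases le_total 0 κ with hκ | hκ
  · exact (min_le_left _ _).trans (by nlinarith [mul_nonneg hκ (sq_nonneg s)])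
  · refine (min_le_right _ _).trans ?_
    have : s ^ 2 ≤ r ^ 2 := pow_le_pow_left₀ hs hsr 2
    nlinarith [mul_nonneg (neg_nonneg.2 hκ) (sub_nonneg.2 this)]

theorem riemVolume_closedBall_ne_top (hr : r ∈ radialDomain κ) :
    riemVolume (spaceFormMetric κ n) (Metric.closedBall 0 r) ≠ ∞ := by
  rw [riemVolume_closedBall hr]
  refine ne_top_of_le_ne_top (b := ∫⁻ _ in Metric.closedBall (0 : E n) r,
    ENNReal.ofReal (factorBound κ r ^ n)) ?_ (setLIntegral_mono'
      Metric.isClosed_closedBall.measurableSet fun x hx => ENNReal.ofReal_le_ofReal ?_)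
  · rw [setLIntegral_const]
    exact ENNReal.mul_ne_top ENNReal.ofReal_ne_top measure_closedBall_lt_top.ne
  · have hx' : (0 : ℝ) < 1 + κ / 4 * ‖x‖ ^ 2 := closedBall_subset_spaceFormDomain hr hx
    exact pow_le_pow_left₀ (by positivity)
      (conformalFactor_le_factorBound hr (norm_nonneg x) (mem_closedBall_zero_iff.1 hx)) n

theorem riemVolume_closedBall_ne_zero (hr : r ∈ radialDomain κ) (h0 : 0 < r) :
    riemVolume (spaceFormMetric κ n) (Metric.closedBall 0 r) ≠ 0 := by
  rw [riemVolume_closedBall hr]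
  refine (lt_of_lt_of_le (b := ∫⁻ _ in Metric.closedBall (0 : E n) r,
    ENNReal.ofReal (((1 + |κ| / 4 * r ^ 2)⁻¹) ^ n)) ?_ (setLIntegral_mono'
      Metric.isClosed_closedBall.measurableSet fun x hx => ENNReal.ofReal_le_ofReal ?_)).ne'
  · rw [setLIntegral_const]
    refine ENNReal.mul_pos (ENNReal.ofReal_pos.2 (by positivity)).ne' ?_
    exact (Metric.measure_closedBall_pos volume 0 h0).ne'
  · have hx' : (0 : ℝ) < 1 + κ / 4 * ‖x‖ ^ 2 := closedBall_subset_spaceFormDomain hr hx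
    refine pow_le_pow_left₀ (by positivity) (inv_anti₀ hx' ?_) n
    have h1 : ‖x‖ ^ 2 ≤ r ^ 2 :=
      pow_le_pow_left₀ (norm_nonneg x) (mem_closedBall_zero_iff.1 hx) 2
    have h2 : κ / 4 * ‖x‖ ^ 2 ≤ |κ| / 4 * ‖x‖ ^ 2 := by gcongr; exact le_abs_self κ
    have h3 : |κ| / 4 * ‖x‖ ^ 2 ≤ |κ| / 4 * r ^ 2 := by gcongr
    linarith

/-- The dilation by `r / s` maps the ball of radius `s` onto the ball of radius `r` and expands
every length by at least the factor `K`. -/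
theorem pow_mul_riemVolume_closedBall_le (hr : r ∈ radialDomain κ) (hs : 0 < s) (hsr : s < r)
    {K : ℝ} (hK : 0 ≤ K) (hK' : ∀ ρ, 0 ≤ ρ → ρ ≤ s →
      K * (1 + κ / 4 * ρ ^ 2)⁻¹ ≤ r / s * (1 + κ / 4 * (r / s * ρ) ^ 2)⁻¹) :
    ENNReal.ofReal (K ^ n) * riemVolume (spaceFormMetric κ n) (Metric.closedBall 0 s) ≤
      riemVolume (spaceFormMetric κ n) (Metric.closedBall 0 r) := by
  have ht : 0 < r / s := div_pos (hs.trans hsr) hs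
  have hsJ := mem_radialDomain_of_le hr hs.le hsr.le
  have himage : (fun x : E n => (r / s) • x) '' Metric.closedBall 0 s = Metric.closedBall 0 r := by
    have := smul_closedBall' ht.ne' (0 : E n) s
    rw [smul_zero, Real.norm_of_nonneg ht.le, div_mul_cancel₀ _ hs.ne'] at this
    exact this
  have hderiv : ∀ x ∈ Metric.closedBall (0 : E n) s, HasFDerivWithinAt (fun x : E n => (r / s) • x)
      ((r / s) • ContinuousLinearMap.id ℝ (E n)) (Metric.closedBall 0 s) x := fun x _ =>
    ((hasFDerivAt_id x).const_smul (r / s)).hasFDerivWithinAt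
  have hinj : InjOn (fun x : E n => (r / s) • x) (Metric.closedBall 0 s) :=
    (smul_right_injective _ ht.ne').injOn
  have hdet : |((r / s) • ContinuousLinearMap.id ℝ (E n)).det| = (r / s) ^ n := by
    rw [ContinuousLinearMap.det, ContinuousLinearMap.toLinearMap_smul, LinearMap.det_smul]
    simp [abs_of_pos ht]
  rw [riemVolume_closedBall hsJ, riemVolume_closedBall hr, ← himage,
    lintegral_image_eq_lintegral_abs_det_fderiv_mul volume
      Metric.isClosed_closedBall.measurableSet hderiv hinj, hdet,
    ← lintegral_const_mul' _ _ ENNReal.ofReal_ne_top]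
  refine setLIntegral_mono' Metric.isClosed_closedBall.measurableSet fun x hx => ?_
  have hxs := mem_closedBall_zero_iff.1 hx
  have hx' : (0 : ℝ) < 1 + κ / 4 * ‖x‖ ^ 2 := closedBall_subset_spaceFormDomain hsJ hx
  rw [← ENNReal.ofReal_mul (by positivity), ← ENNReal.ofReal_mul (by positivity), ← mul_pow,
    ← mul_pow, norm_smul, Real.norm_of_nonneg ht.le]
  exact ENNReal.ofReal_le_ofReal
    (pow_le_pow_left₀ (by positivity) (hK' _ (norm_nonneg x) hxs) n)

/-- The volumes of concentric balls grow exponentially in the dimension, at a rate independent of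
the dimension. The assumption `κ / 4 * r ^ 2 ≤ 1` says that the ball is contained in a
hemisphere if `κ > 0`, and is vacuous otherwise. -/
theorem exists_pow_mul_riemVolume_closedBall_le (hr : r ∈ radialDomain κ) (hs : 0 < s)
    (hsr : s < r) (hhemi : κ / 4 * r ^ 2 ≤ 1) :
    ∃ K : ℝ, 1 < K ∧ ∀ n : ℕ,
      ENNReal.ofReal (K ^ n) * riemVolume (spaceFormMetric κ n) (Metric.closedBall 0 s) ≤
        riemVolume (spaceFormMetric κ n) (Metric.closedBall 0 r) := by
  have hp : 0 < 1 + κ / 4 * r ^ 2 := hr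
  have h0 := hs.trans hsr
  have ht : 1 < r / s := (one_lt_div hs).2 hsr
  -- The second entry is the quotient of the circumferences of the two spheres.
  set K := min (r / s) (r / s * (1 + κ / 4 * s ^ 2) / (1 + κ / 4 * r ^ 2)) with hKdef
  have hrs : κ / 4 * (r * s) < 1 := by
    rcases le_or_gt κ 0 with hκ | hκ
    · have : κ / 4 * (r * s) ≤ 0 := mul_nonpos_of_nonpos_of_nonneg (by linarith) (by positivity)
      linarith
    · refine lt_of_lt_of_le ?_ hhemi
      rw [sq]
      gcongr
  have hK : 1 < K := by
    refine lt_min ht ?_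
    rw [lt_div_iff₀ hp, one_mul, div_mul_eq_mul_div r, lt_div_iff₀ hs]
    nlinarith [mul_pos (sub_pos.2 hsr) (sub_pos.2 hrs)]
  refine ⟨K, hK, fun n => pow_mul_riemVolume_closedBall_le hr hs hsr (by linarith) ?_⟩
  intro ρ hρ0 hρ
  have htρ : r / s * ρ ≤ r := by
    calc r / s * ρ ≤ r / s * s := by gcongr
      _ = r := div_mul_cancel₀ _ hs.ne'
  have hp1 : 0 < 1 + κ / 4 * ρ ^ 2 := mem_radialDomain_of_le hr hρ0 (hρ.trans hsr.le)
  have hp2 : 0 < 1 + κ / 4 * (r / s * ρ) ^ 2 := mem_radialDomain_of_le hr (by positivity) htρ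
  rw [← div_eq_mul_inv, ← div_eq_mul_inv, div_le_div_iff₀ hp1 hp2]
  -- Both sides are affine in `ρ²`, so it suffices to compare them at `ρ = 0` and `ρ = s`.
  have hK1 : K ≤ r / s := min_le_left _ _
  have hK2 : K * (1 + κ / 4 * r ^ 2) ≤ r / s * (1 + κ / 4 * s ^ 2) :=
    (le_div_iff₀ hp).1 (min_le_right _ _)
  have hu : ρ ^ 2 / s ^ 2 ≤ 1 := by
    rw [div_le_one (by positivity)]
    exact pow_le_pow_left₀ hρ0 hρ 2
  have hu0 : 0 ≤ ρ ^ 2 / s ^ 2 := by positivity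
  have e1 : (r / s * ρ) ^ 2 = ρ ^ 2 / s ^ 2 * r ^ 2 := by field_simp
  have e2 : ρ ^ 2 = ρ ^ 2 / s ^ 2 * s ^ 2 := by field_simp
  rw [e1]
  nth_rewrite 2 [e2]
  generalize ρ ^ 2 / s ^ 2 = u at hu hu0
  nlinarith [mul_le_mul_of_nonneg_left hK1 (sub_nonneg.2 hu),
    mul_le_mul_of_nonneg_left hK2 hu0]

/-! ### Observables on the ball -/

theorem riemEDist_closedBall_le (hr : r ∈ radialDomain κ) {x y : E n}
    (hx : x ∈ Metric.closedBall 0 r) (hy : y ∈ Metric.closedBall 0 r) :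
    riemEDist (spaceFormMetric κ n) (Metric.closedBall 0 r) x y ≤
      ENNReal.ofReal (factorBound κ r * ‖y - x‖) := by
  have hseg := (convex_closedBall (0 : E n) r).segment_subset hx hy
  refine iInf₂_le_of_le _ ⟨(contDiff_lineMap x y).contDiffOn, fun t ht => hseg ?_, by simp,
    by simp⟩ (riemLength_segment_le fun z hz => ⟨closedBall_subset_spaceFormDomain hr (hseg hz),
      conformalFactor_le_factorBound hr (norm_nonneg z) (mem_closedBall_zero_iff.1 (hseg hz))⟩)
  rw [segment_eq_image_lineMap]
  exact mem_image_of_mem _ ht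

theorem exists_mem_sphere_norm_sub_eq [Nonempty (Fin n)] (h0 : 0 < r) {x : E n} (hx : ‖x‖ ≤ r) :
    ∃ y : E n, ‖y‖ = r ∧ ‖y - x‖ = r - ‖x‖ := by
  rcases eq_or_ne x 0 with rfl | hx0
  · obtain ⟨y, hy⟩ := NormedSpace.sphere_nonempty (x := (0 : E n)).2 h0.le
    have := mem_sphere_zero_iff_norm.1 hy
    exact ⟨y, this, by simpa using this⟩
  · have hpos : 0 < ‖x‖ := norm_pos_iff.2 hx0
    refine ⟨(r / ‖x‖) • x, ?_, ?_⟩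
    · rw [norm_smul, norm_div, norm_norm, Real.norm_of_nonneg h0.le, div_mul_cancel₀ _ hpos.ne']
    · have e : (r / ‖x‖) • x - x = (r / ‖x‖ - 1) • x := by rw [sub_smul, one_smul]
      have h1 : 0 ≤ r / ‖x‖ - 1 := sub_nonneg.2 ((one_le_div hpos).2 hx)
      rw [e, norm_smul, Real.norm_of_nonneg h1, sub_mul, one_mul, div_mul_cancel₀ _ hpos.ne']

theorem ballEDist_le (hr : r ∈ radialDomain κ) (hB : spaceFormBall κ n R = Metric.closedBall 0 r)
    (x y : spaceFormBall κ n R) :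
    ballEDist κ n R x y ≤ ENNReal.ofReal (factorBound κ r * ‖(y : E n) - x‖) := by
  have hsub : ∀ z : spaceFormBall κ n R, (z : E n) ∈ Metric.closedBall 0 r := fun z => hB ▸ z.2
  refine le_of_eq_of_le ?_ (riemEDist_closedBall_le hr (hsub x) (hsub y))
  exact congrArg (fun B => riemEDist (spaceFormMetric κ n) B x y) hB

/-- Observables are measurable, so the push-forward measure on the screen is not the junk value
`0`. -/
theorem measurable_of_edist_le_ballEDist (hr : r ∈ radialDomain κ)
    (hB : spaceFormBall κ n R = Metric.closedBall 0 r) {φ : spaceFormBall κ n R → ℝ≥0}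
    (hφ : ∀ x y, edist (φ x) (φ y) ≤ ballEDist κ n R x y) : Measurable φ := by
  refine (LipschitzWith.continuous (K := (factorBound κ r).toNNReal) fun x y => ?_).measurable
  refine ((hφ x y).trans (ballEDist_le hr hB x y)).trans_eq ?_
  rw [ENNReal.ofReal_mul (factorBound_pos hr).le, edist_comm, Subtype.edist_eq, edist_dist,
    dist_eq_norm, ENNReal.ofReal]

theorem edist_zero_eq_coe (t : ℝ≥0) : edist t 0 = t := by
  rw [edist_nndist, NNReal.nndist_zero_eq_val']

theorem observable_le_of_boundary_eq_zero [Nonempty (Fin n)] (hr : r ∈ radialDomain κ) (h0 : 0 < r)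
    (hB : spaceFormBall κ n R = Metric.closedBall 0 r) {φ : spaceFormBall κ n R → ℝ≥0}
    (hφ : ∀ x y, edist (φ x) (φ y) ≤ ballEDist κ n R x y) (hφ0 : ∀ x ∈ ballBoundary κ n R, φ x = 0)
    (x : spaceFormBall κ n R) :
    (φ x : ℝ≥0∞) ≤ ENNReal.ofReal (factorBound κ r * (r - ‖(x : E n)‖)) := by
  obtain ⟨y, hy, hyx⟩ := exists_mem_sphere_norm_sub_eq h0 (x := (x : E n))
    (mem_closedBall_zero_iff.1 (hB ▸ x.2))
  have hyB : y ∈ spaceFormBall κ n R := by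
    rw [hB]
    exact mem_closedBall_zero_iff.2 hy.le
  have hyF : (⟨y, hyB⟩ : spaceFormBall κ n R) ∈ ballBoundary κ n R := by
    change y ∈ frontier (spaceFormBall κ n R)
    rw [hB, frontier_closedBall_zero h0]
    exact mem_sphere_zero_iff_norm.2 hy
  have h := (hφ x ⟨y, hyB⟩).trans (ballEDist_le hr hB x ⟨y, hyB⟩)
  rwa [hφ0 _ hyF, hyx, edist_zero_eq_coe] at h

theorem ballMeasure_apply (hB : spaceFormBall κ n R = Metric.closedBall 0 r)
    (A : Set (spaceFormBall κ n R)) :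
    ballMeasure κ n R A = (riemVolume (spaceFormMetric κ n) (Metric.closedBall 0 r))⁻¹ *
      riemVolume (spaceFormMetric κ n) (Subtype.val '' A) := by
  have hm : MeasurableSet (spaceFormBall κ n R) := by
    rw [hB]
    exact Metric.isClosed_closedBall.measurableSet
  rw [ballMeasure, Measure.smul_apply, comap_subtype_coe_apply hm, smul_eq_mul,
    congrArg (riemVolume (spaceFormMetric κ n)) hB]

theorem isProbabilityMeasure_ballMeasure (hr : r ∈ radialDomain κ) (h0 : 0 < r)
    (hB : spaceFormBall κ n R = Metric.closedBall 0 r) :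
    IsProbabilityMeasure (ballMeasure κ n R) := by
  refine ⟨?_⟩
  rw [ballMeasure_apply hB, image_univ, Subtype.range_coe, hB]
  exact ENNReal.inv_mul_cancel (riemVolume_closedBall_ne_zero hr h0)
    (riemVolume_closedBall_ne_top hr)

/-- If the smaller concentric ball of radius `r - δ` carries at most the fraction `η` of the volume,
then every observable is small outside a set of measure `η`. -/
theorem obsInRad_ball_le [Nonempty (Fin n)] (hr : r ∈ radialDomain κ) (h0 : 0 < r)
    (hB : spaceFormBall κ n R = Metric.closedBall 0 r) {η : ℝ} (hη : 0 ≤ η)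
    (hvol : riemVolume (spaceFormMetric κ n) (Metric.closedBall 0 (r - δ)) ≤
      ENNReal.ofReal η * riemVolume (spaceFormMetric κ n) (Metric.closedBall 0 r)) :
    obsInRad (ballEDist κ n R) (ballMeasure κ n R) (ballBoundary κ n R) η ≤
      ENNReal.ofReal (factorBound κ r * δ) := by
  have := isProbabilityMeasure_ballMeasure hr h0 hB
  refine iSup₂_le fun φ hφ => ?_
  have hmeas := measurable_of_edist_le_ballEDist hr hB hφ.1
  set a : ℝ≥0 := (factorBound κ r * δ).toNNReal with ha
  refine iInf₂_le_of_le (Iic a) ⟨measurableSet_Iic, ?_⟩ (iSup₂_le fun t ht => ?_)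
  · set A : Set (spaceFormBall κ n R) := {x | ‖(x : E n)‖ ≤ r - δ} with hA
    have hAm : MeasurableSet A :=
      measurableSet_le (measurable_norm.comp measurable_subtype_coe) measurable_const
    have hAμ : ballMeasure κ n R A ≤ ENNReal.ofReal η := by
      have hsub : Subtype.val '' A ⊆ Metric.closedBall (0 : E n) (r - δ) := by
        rintro _ ⟨x, hx, rfl⟩
        exact mem_closedBall_zero_iff.2 hx
      rw [ballMeasure_apply hB, mul_comm, ← div_eq_mul_inv]
      exact ENNReal.div_le_of_le_mul ((measure_mono hsub).trans hvol)
    rw [Measure.map_apply hmeas measurableSet_Iic]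
    calc ENNReal.ofReal (1 - η) = 1 - ENNReal.ofReal η := by
          rw [ENNReal.ofReal_sub _ hη, ENNReal.ofReal_one]
      _ ≤ 1 - ballMeasure κ n R A := tsub_le_tsub_left hAμ 1
      _ = ballMeasure κ n R Aᶜ := (prob_compl_eq_one_sub hAm).symm
      _ ≤ ballMeasure κ n R (φ ⁻¹' Iic a) := measure_mono fun x hx => ?_
    have hx' : r - δ < ‖(x : E n)‖ := not_le.1 hx
    have h1 := observable_le_of_boundary_eq_zero hr h0 hB hφ.1 hφ.2 x
    rw [mem_preimage, mem_Iic, ← ENNReal.coe_le_coe]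
    refine h1.trans (ENNReal.ofReal_le_ofReal ?_)
    exact mul_le_mul_of_nonneg_left (by linarith) (factorBound_pos hr).le
  · refine (iInf₂_le (0 : ℝ≥0) (mem_singleton _)).trans ?_
    change edist t 0 ≤ _
    rw [edist_zero_eq_coe, ENNReal.ofReal, ← ha]
    exact ENNReal.coe_le_coe.2 ht

theorem isBoundaryConcentrationFamily_ball (hr : r ∈ radialDomain κ) (h0 : 0 < r)
    (hhemi : κ / 4 * r ^ 2 ≤ 1) (hB : ∀ n, spaceFormBall κ n R = Metric.closedBall 0 r) :
    IsBoundaryConcentrationFamily (fun n => spaceFormBall κ n R) (fun n => ballEDist κ n R)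
      (fun n => ballMeasure κ n R) (fun n => ballBoundary κ n R) := by
  intro η hη
  refine ENNReal.tendsto_nhds_zero.2 fun ε hε => ?_
  obtain ⟨e, he0, heε⟩ := ENNReal.lt_iff_exists_nnreal_btwn.1 hε
  have he : (0 : ℝ) < e := by exact_mod_cast he0
  have hM := factorBound_pos hr
  obtain ⟨δ, hδ0, hδr, hδe⟩ : ∃ δ, 0 < δ ∧ δ < r ∧ factorBound κ r * δ ≤ e := by
    refine ⟨min (r / 2) (e / factorBound κ r), lt_min (by positivity) (by positivity),
      (min_le_left _ _).trans_lt (by linarith), ?_⟩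
    calc factorBound κ r * min (r / 2) (e / factorBound κ r)
        ≤ factorBound κ r * (e / factorBound κ r) := by gcongr; exact min_le_right _ _
      _ = e := mul_div_cancel₀ _ hM.ne'
  obtain ⟨K, hK, hvol⟩ := exists_pow_mul_riemVolume_closedBall_le hr (sub_pos.2 hδr)
    (sub_lt_self r hδ0) hhemi
  filter_upwards [(tendsto_pow_atTop_atTop_of_one_lt hK).eventually_ge_atTop η⁻¹,
    eventually_ge_atTop 1] with n hn hn1
  have : Nonempty (Fin n) := ⟨⟨0, hn1⟩⟩
  refine (obsInRad_ball_le (δ := δ) hr h0 (hB n) hη.le ?_).trans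
    (le_trans ?_ heε.le)
  · set v := riemVolume (spaceFormMetric κ n) (Metric.closedBall 0 (r - δ))
    calc v = 1 * v := (one_mul v).symm
      _ ≤ ENNReal.ofReal (η * K ^ n) * v := by
        gcongr
        rw [ENNReal.one_le_ofReal]
        calc (1 : ℝ) = η * η⁻¹ := (mul_inv_cancel₀ hη.ne').symm
          _ ≤ η * K ^ n := by gcongr
      _ = ENNReal.ofReal η * (ENNReal.ofReal (K ^ n) * v) := by
        rw [ENNReal.ofReal_mul hη.le, mul_assoc]
      _ ≤ _ := by gcongr; exact hvol n
  · rw [← ENNReal.ofReal_coe_nnreal]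
    exact ENNReal.ofReal_le_ofReal hδe

end BoundaryConcentration

theorem corollary1p5 (κ lam : ℝ) (h : ConvexBallCondition κ lam) :
    ∃ C : ℝ,
      (∀ n : ℕ, 2 ≤ n → ∀ R : ℝ, IsBallModelRadius κ lam n R ↔ R = C) ∧
      IsBoundaryConcentrationFamily (fun n => spaceFormBall κ n C)
        (fun n => ballEDist κ n C) (fun n => ballMeasure κ n C) (fun n => ballBoundary κ n C) := by
  have hr := h.modelRadius_mem
  have h0 := h.modelRadius_pos
  refine ⟨radialDist κ (modelRadius κ lam), fun n hn R => isBallModelRadius_iff h hn R,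
    isBoundaryConcentrationFamily_ball hr h0 ?_ fun n => spaceFormBall_radialDist hr h0⟩
  linarith [h.modelRadius_root, mul_nonneg h.2 h0.le]
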